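/- **Setting.** Fix $\mathcal Y\subseteq\mathbb R$, $\alpha,\alpha'\in(0,1)$, $\mu^*\in\mathbb R$ and $\delta>0$. For each $L\ge 1$ let $\mathcal C_{1,\alpha},\dots,\mathcal C_{L,\alpha}\subseteq\mathcal Y$ be random sets (they and the probability space may depend on $L$), with $\{y\in\mathcal C_{\ell,\alpha}\}$ measurable for $y\in\mathcal Y$. Suppose they are $\delta$-weakly dependent with Gaussian summary statistics: for each $L$ there is a covariance matrix $\Sigma=\Sigma^{(L)}=(\sigma_{ij})\in\mathbb R^{L\times L}$ with $\sigma_{\ell\ell}=1$ for all $\ell$ and $$L^{-2}\sum_{i=1}^L\sum_{j=1}^L|\sigma_{ij}|=O(L^{-\delta})\qquad (L\to\infty),$$ such that, for $Z=(Z_1,\dots,Z_L)\sim\mathcal N(\mu^*\mathbf 1_L,\Sigma)$ and every $y\in\mathcal Y$, the joint law of the indicators $(\mathbf 1\{y\in\mathcal C_{\ell,\alpha}\})_{\ell\le L}$ equals that of $(\mathbf 1\{|Z_\ell-y|\le z_{1-\alpha/2}\})_{\ell\le L}$, where $z_{1-\alpha/2}$ is the $(1-\alpha/2)$-quantile of the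 standard normal law. (In particular $\mathbb P(y\notin\mathcal C_{1,\alpha})$ does not depend on $L$.) For $y\in\mathcal Y$ and $\ell\le L$ define the synthetic p-value $$p_\ell(y)=U_{\ell,1}\,\mathbf 1\{y\notin\mathcal C_{\ell,\alpha}\}+U_{\ell,2}\,\mathbf 1\{y\in\mathcal C_{\ell,\alpha}\},$$ where $U_{\ell,1}\sim\mathrm{Unif}(0,\alpha)$ and $U_{\ell,2}\sim\mathrm{Unif}(\alpha,1)$, $\ell\le L$ (drawn for the candidate $y$), are mutually independent and jointly independent of the indicators $(\mathbf 1\{y\in\mathcal C_{\ell,\alpha}\})_{\ell\le L}$. Let $f:[0,\infty)\to[0,\infty]$ be nonincreasing and upper semicontinuous with $f(0)=\infty$, $\int_0^1 f(t)\,dt=1$, and $f<C_f$ on $(0,\infty)$ for some constant $C_f>0$. For $a\in(0,1)$ put $$R_a=\Big\{p\in[0,1]^L:\ \frac1L\sum_{\ell=1}^L f(p_\ell/a)\ge 1\Big\},\qquad \bar p(y)=\inf\{a\in(0,1):(p_1(y),\dots,p_L(y))\in R_a\}$$ (with $\inf\emptyset=1$), and let the merged set be $\bar{\mathcal C}_{\alpha'}=\{y\in\mathcal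 Y:\bar p(y)>\alpha'\}$. **Theorem.** For every $y\in\mathcal Y$ with $\Gamma(y,\alpha,\alpha')>1$, where $$\Gamma(y,\alpha,\alpha')=\Big\{\frac{\alpha'}{\alpha}\int_0^{\alpha/\alpha'}f(t)\,dt-\frac{\alpha'}{1-\alpha}\int_{\alpha/\alpha'}^1 f(t)\,dt\Big\}\big\{\mathbb P(y\notin\mathcal C_{1,\alpha})-\alpha\big\}+\alpha'$$ (integrals oriented if $\alpha>\alpha'$), one has $$\lim_{L\to\infty}\mathbb P\big(y\notin\bar{\mathcal C}_{\alpha'}\big)=1 .$$ -/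

import Mathlib

open MeasureTheory ProbabilityTheory Filter Asymptotics
open scoped ENNReal NNReal Topology

noncomputable section

namespace SAT

/-- The `p`-quantile of the standard normal distribution,
`inf {x | Φ(x) ≥ p}` (a genuine infimum for `p ∈ (0,1)`). -/
def normalQuantile (p : ℝ) : ℝ :=
  sInf {x : ℝ | p ≤ cdf (gaussianReal 0 1) x}

/-- `δ`-weakly dependent uncertainty sets, as the number `L` of sets grows.
For every `L` there are `L` random sets `C L ℓ` on the probability space `(Ω L, P L)`, with control
levels `a L ℓ`. The joint law of the coverage indicators `(1{y ∈ C L ℓ})_ℓ` is the joint law of the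
indicators `(1{|Z_ℓ - y| / √σ_ℓℓ ≤ z_{1 - a_ℓ / 2}})_ℓ`, where `Z ∼ N(μ, S)`; the joint law of
finitely many indicators is encoded by the probabilities that all members of a given
sub-collection are equal to one. -/
structure IsWeaklyDependent {Ω : ℕ → Type*} [∀ L, MeasurableSpace (Ω L)]
    (P : ∀ L, Measure (Ω L)) (Y : Set ℝ) (δ : ℝ)
    (μ : ∀ L, EuclideanSpace ℝ (Fin L)) (S : ∀ L, Matrix (Fin L) (Fin L) ℝ)
    (a : ∀ L, Fin L → ℝ) (C : ∀ L, Fin L → Ω L → Set ℝ) : Prop where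
  delta_pos : 0 < δ
  posSemidef : ∀ L, (S L).PosSemidef
  weak : (fun L : ℕ => ((L : ℝ) ^ 2)⁻¹ * ∑ i, ∑ j, |S L i j|)
    =O[atTop] fun L : ℕ => (L : ℝ) ^ (-δ)
  joint_law : ∀ y ∈ Y, ∀ (L : ℕ) (T : Finset (Fin L)),
    P L {ω | ∀ ℓ ∈ T, y ∈ C L ℓ ω} =
      multivariateGaussian (μ L) (S L)
        {z | ∀ ℓ ∈ T, |z ℓ - y| / √(S L ℓ ℓ) ≤ normalQuantile (1 - a L ℓ / 2)}

open Classical in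
/-- The synthetic p-value at `y` of the set `C`: the draw `u₁` (uniform on `(0, a)`) when `y ∉ C`,
the draw `u₂` (uniform on `(a, 1)`) when `y ∈ C`. -/
def syntheticP (y : ℝ) (C : Set ℝ) (u₁ u₂ : ℝ) : ℝ :=
  if y ∈ C then u₂ else u₁

/-- The random draws behind the synthetic p-values at a candidate `y`:
`U₁ ℓ ∼ Unif(0, a ℓ)` and `U₂ ℓ ∼ Unif(a ℓ, 1)`, all mutually independent, and jointly independent
of the coverage indicators of `y`. -/
structure IsSyntheticDraw {ι Ω : Type*} [MeasurableSpace Ω] (P : Measure Ω) (y : ℝ)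
    (a : ι → ℝ) (C : ι → Ω → Set ℝ) (U₁ U₂ : ι → Ω → ℝ) : Prop where
  law₁ : ∀ ℓ, HasLaw (U₁ ℓ) (cond volume (Set.Ioo 0 (a ℓ))) P
  law₂ : ∀ ℓ, HasLaw (U₂ ℓ) (cond volume (Set.Ioo (a ℓ) 1)) P
  indep : iIndepFun (Sum.elim U₁ U₂) P
  indep_sets : IndepFun (fun ω (i : ι ⊕ ι) => Sum.elim U₁ U₂ i ω)
    (fun ω (ℓ : ι) => (y ∈ C ℓ ω : Prop)) P

/-- The rejection region `R_a = {p ∈ [0,1]^ι : ∑ λ_ℓ f_ℓ(p_ℓ / a) ≥ 1}`. Only the values of the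
`f ℓ : [0, ∞) → [0, ∞]` on `[0, ∞)` matter when `a > 0`. -/
def rejectionRegion {ι : Type*} [Fintype ι] (lam : ι → ℝ≥0) (f : ι → ℝ → ℝ≥0∞) (a : ℝ) :
    Set (ι → ℝ) :=
  {p | (∀ ℓ, p ℓ ∈ Set.Icc (0 : ℝ) 1) ∧ 1 ≤ ∑ ℓ, (lam ℓ : ℝ≥0∞) * f ℓ (p ℓ / a)}

/-- The aggregated p-value `inf {a ∈ (0,1) : p ∈ R_a}`. It takes values in `[0,1]`, so the infimum
of the empty set is `1`; inserting `1` changes nothing otherwise. -/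
def aggregateP {ι : Type*} [Fintype ι] (lam : ι → ℝ≥0) (f : ι → ℝ → ℝ≥0∞) (p : ι → ℝ) : ℝ :=
  sInf (insert 1 {a : ℝ | a ∈ Set.Ioo (0 : ℝ) 1 ∧ p ∈ rejectionRegion lam f a})

/-- The merged set `{y ∈ Y : p̄(y) > a'}`, where `p̄(y)` aggregates the p-values `p y`. -/
def mergedSet {ι : Type*} [Fintype ι] (Y : Set ℝ) (lam : ι → ℝ≥0) (f : ι → ℝ → ℝ≥0∞)
    (p : ℝ → ι → ℝ) (a' : ℝ) : Set ℝ :=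
  {y ∈ Y | a' < aggregateP lam f (p y)}

/-- Admissible and bounded calibrators `f : [0, ∞) → [0, ∞]`
(the values on the negative half-line are irrelevant). -/
structure IsBoundedAdmissibleCalibrator (f : ℝ → ℝ≥0∞) : Prop where
  antitone : AntitoneOn f (Set.Ici 0)
  upperSemicontinuous : UpperSemicontinuousOn f (Set.Ici 0)
  apply_zero : f 0 = ∞
  lintegral_eq_one : ∫⁻ t in Set.Icc (0 : ℝ) 1, f t = 1
  bounded : ∃ Cf : ℝ, 0 < Cf ∧ ∀ t, 0 < t → f t < ENNReal.ofReal Cf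

/-- `Γ(y, α, α')` as a function of `q = ℙ(y ∉ C_{1,α})`. Both integrals are oriented. -/
def Gam (f : ℝ → ℝ≥0∞) (α α' q : ℝ) : ℝ :=
  (α' / α * (∫ t in (0 : ℝ)..(α / α'), (f t).toReal)
    - α' / (1 - α) * (∫ t in (α / α')..1, (f t).toReal)) * (q - α) + α'

end SAT

end

/-! This is a Chebyshev argument. Let `r` be the common coverage probability and `A`, `B` the means
of f(·/α') under Unif(0, α) and Unif(α, 1). Each f(p_ℓ/α') has mean (1 - r)A + rB, and by `Gam_le`
this is at least Γ > 1. If the average of the f(p_ℓ/α') is at least 1, then α' itself competes in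
the infimum defining the aggregated p-value (`aggregateP_le`), so y is excluded. It remains to show
that the average concentrates.

The centred sum splits as (B - A)X + N, with X the centred number of covering sets and N the noise
of the uniform draws. The terms of N are orthogonal, so E N² = O(L). E X² is the sum of the
covariances of pairs of coverage indicators. By `gaussian_pair_bound`, each is at most ε + K|σ_ij|,
with K depending on ε but not on L or Σ. After division by L², weak dependence leaves only a
multiple of ε, which is arbitrary. Only the decay of the mean of |σ_ij| matters, not its rate. -/

namespace SAT

/-! ### Pairs of Gaussian coordinates -/

/-- Two coordinates of a Gaussian vector with unit variances and common mean, expressed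
through independent Gaussian variables. -/
theorem multivariateGaussian_pair {ι : Type*} [Fintype ι] [DecidableEq ι] {m : ℝ}
    {S : Matrix ι ι ℝ} (hS : S.PosSemidef) (hd : ∀ i, S i i = 1) (i j : ι)
    {A : Set ℝ} (hA : MeasurableSet A) :
    multivariateGaussian (WithLp.toLp 2 fun _ => m) S {z | z i ∈ A ∧ z j ∈ A} =
      ((gaussianReal m 1).prod (gaussianReal 0 1))
        {p | p.1 ∈ A ∧ √(1 - S i j ^ 2) * p.2 + (m - S i j * m) + S i j * p.1 ∈ A} := by
  set M := multivariateGaussian (WithLp.toLp 2 fun _ => m) S with hM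
  set ρ := S i j with hρ
  have hlaw : HasGaussianLaw (fun z : EuclideanSpace ℝ ι => (z i, z j - ρ * z i)) M :=
    IsGaussian.hasGaussianLaw_id.map_fun
      ((EuclideanSpace.proj (𝕜 := ℝ) i).prod
        (EuclideanSpace.proj (𝕜 := ℝ) j - ρ • EuclideanSpace.proj (𝕜 := ℝ) i))
  have hmem : ∀ k, MemLp (fun z : EuclideanSpace ℝ ι => z k) 2 M := fun k =>
    (IsGaussian.hasGaussianLaw_id.map_fun (EuclideanSpace.proj (𝕜 := ℝ) k)).memLp_two
  have hmean : ∀ k, ∫ z : EuclideanSpace ℝ ι, z k ∂M = m := fun k => by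
    have h := (measurePreserving_eval_multivariateGaussian
      (μ := WithLp.toLp 2 fun _ : ι => m) hS (i := k)).hasLaw.integral_eq
    simpa using h
  -- The regression residual of coordinate `j` on coordinate `i` is uncorrelated with the latter,
  -- hence independent of it by joint Gaussianity.
  have hcov : cov[fun z : EuclideanSpace ℝ ι => z i, fun z => z j - ρ * z i; M] = 0 := by
    rw [covariance_fun_sub_right (hmem i) (hmem j) ((hmem i).const_mul ρ),
      covariance_const_mul_right, covariance_eval_multivariateGaussian hS,
      covariance_eval_multivariateGaussian hS, hd]
    simp [hρ]
  have hind := hlaw.indepFun_of_covariance_eq_zero hcov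
  have hvar : Var[fun z : EuclideanSpace ℝ ι => z j - ρ * z i; M] = 1 - ρ ^ 2 := by
    rw [variance_fun_sub (hmem j) ((hmem i).const_mul ρ), variance_const_mul,
      covariance_const_mul_right, covariance_eval_multivariateGaussian hS,
      variance_eval_multivariateGaussian hS, variance_eval_multivariateGaussian hS, hd, hd,
      ← hS.isHermitian.apply j i]
    simp only [star_trivial, ← hρ]
    ring
  have hnn : 0 ≤ 1 - ρ ^ 2 := hvar ▸ variance_nonneg _ _
  have hR : HasLaw (fun z : EuclideanSpace ℝ ι => z j - ρ * z i)
      (gaussianReal (m - ρ * m) (1 - ρ ^ 2).toNNReal) M := by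
    refine ⟨by fun_prop, ?_⟩
    rw [hlaw.snd.map_eq_gaussianReal, hvar, integral_sub ((hmem j).integrable (by simp))
      (((hmem i).integrable (by simp)).const_mul ρ), integral_const_mul, hmean, hmean]
  have hX : HasLaw (fun z : EuclideanSpace ℝ ι => z i) (gaussianReal m 1) M := by
    have h := (measurePreserving_eval_multivariateGaussian
      (μ := WithLp.toLp 2 fun _ : ι => m) hS (i := i)).hasLaw
    simpa [hd] using h
  have hG : HasLaw (fun g : ℝ => √(1 - ρ ^ 2) * g + (m - ρ * m))
      (gaussianReal (m - ρ * m) (1 - ρ ^ 2).toNNReal) (gaussianReal 0 1) := by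
    have h := gaussianReal_add_const
      (gaussianReal_const_mul (HasLaw.id (μ := gaussianReal 0 1)) (√(1 - ρ ^ 2))) (m - ρ * m)
    convert h using 2
    · simp
    · simp
    · apply NNReal.eq
      rw [mul_one, Real.coe_toNNReal _ hnn]
      exact (Real.sq_sqrt hnn).symm
  have hprod := (indepFun_iff_hasLaw_prodMk_prod hX hR).1 hind
  have hset : MeasurableSet {p : ℝ × ℝ | p.1 ∈ A ∧ p.2 + ρ * p.1 ∈ A} :=
    (measurable_fst hA).inter
      ((measurable_snd.add (measurable_fst.const_mul ρ)) hA)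
  have h1 := hprod.measure_eq (p := fun p : ℝ × ℝ => p.1 ∈ A ∧ p.2 + ρ * p.1 ∈ A) hset
  have h2 : MeasurePreserving (Prod.map id fun g : ℝ => √(1 - ρ ^ 2) * g + (m - ρ * m))
      ((gaussianReal m 1).prod (gaussianReal 0 1))
      ((gaussianReal m 1).prod (gaussianReal (m - ρ * m) (1 - ρ ^ 2).toNNReal)) :=
    (MeasurePreserving.id _).prod (hG.measurePreserving (by fun_prop))
  have h3 := h2.measure_preimage hset.nullMeasurableSet
  simp only [sub_add_cancel] at h1
  rw [h1, ← h3]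
  rfl

/-- The underlying pair of independent Gaussians is fixed and only the event moves with `ρ`. Its
indicator converges off the boundary |g + m - y| = c, which is null, so dominated convergence
applies. -/
theorem tendsto_gaussian_pair (m y c : ℝ) :
    Tendsto (fun ρ : ℝ => ((gaussianReal m 1).prod (gaussianReal 0 1))
        {p | |p.1 - y| ≤ c ∧ |√(1 - ρ ^ 2) * p.2 + (m - ρ * m) + ρ * p.1 - y| ≤ c})
      (𝓝 0) (𝓝 (gaussianReal m 1 {z | |z - y| ≤ c} ^ 2)) := by
  have hset : MeasurableSet {z : ℝ | |z - y| ≤ c} :=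
    measurableSet_le (by fun_prop) (by fun_prop)
  have hlim : gaussianReal m 1 {z | |z - y| ≤ c} ^ 2 =
      ((gaussianReal m 1).prod (gaussianReal 0 1))
        {p | |p.1 - y| ≤ c ∧ |p.2 + m - y| ≤ c} := by
    have h := (gaussianReal_add_const (HasLaw.id (μ := gaussianReal 0 1)) m).measure_eq
      (p := fun z => |z - y| ≤ c) hset
    simp only [zero_add, id] at h
    rw [pow_two]
    nth_rewrite 2 [← h]
    rw [← Measure.prod_prod]
    rfl
  rw [hlim]
  have hcont : ∀ p : ℝ × ℝ, Tendsto
      (fun ρ : ℝ => |√(1 - ρ ^ 2) * p.2 + (m - ρ * m) + ρ * p.1 - y|) (𝓝 0)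
      (𝓝 |p.2 + m - y|) := fun p => by
    have h : Continuous fun ρ : ℝ => |√(1 - ρ ^ 2) * p.2 + (m - ρ * m) + ρ * p.1 - y| := by
      fun_prop
    simpa using h.tendsto 0
  have hae : ∀ᵐ p ∂(gaussianReal m 1).prod (gaussianReal 0 1), |p.2 + m - y| ≠ c := by
    have h0 : ∀ᵐ g ∂gaussianReal 0 1, |g + m - y| ≠ c := by
      have := nullSingletonClass_gaussianReal (μ := 0) (v := 1) one_ne_zero
      have hfin : ({y - m + c, y - m - c} : Set ℝ).Finite := by simp
      filter_upwards [hfin.countable.ae_notMem (gaussianReal 0 1)] with g hg h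
      apply hg
      rcases abs_choice (g + m - y) with h' | h' <;> rw [h'] at h
      · left; linarith
      · right; simp only [Set.mem_singleton_iff]; linarith
    exact Measure.quasiMeasurePreserving_snd.ae h0
  have hmeas : ∀ {φ : ℝ × ℝ → ℝ}, Measurable φ →
      MeasurableSet {p : ℝ × ℝ | |p.1 - y| ≤ c ∧ |φ p - y| ≤ c} := fun hφ =>
    (measurable_fst hset).inter (hφ hset)
  refine tendsto_measure_of_ae_tendsto_indicator_of_isFiniteMeasure (𝓝 0) ?_ ?_ ?_
  · exact hmeas (by fun_prop)
  · exact fun ρ => hmeas (by fun_prop)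
  · filter_upwards [hae] with p hp
    rcases lt_or_gt_of_ne hp with h | h
    · filter_upwards [(hcont p).eventually_lt_const h] with ρ hρ
      simp only [hρ.le, h.le]
    · filter_upwards [(hcont p).eventually_const_lt h] with ρ hρ
      simp only [hρ.not_ge, h.not_ge]

/-- The covariance of interval indicators of two coordinates of a Gaussian vector with unit
variances is small when their correlation is small, uniformly over the vectors. -/
theorem gaussian_pair_bound (m y c : ℝ) {ε : ℝ} (hε : 0 < ε) :
    ∃ K : ℝ, 0 ≤ K ∧ ∀ (L : ℕ) (S : Matrix (Fin L) (Fin L) ℝ), S.PosSemidef →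
      (∀ i, S i i = 1) → ∀ i j,
      (multivariateGaussian (WithLp.toLp 2 fun _ => m) S).real
          {z | |z i - y| ≤ c ∧ |z j - y| ≤ c} -
        (gaussianReal m 1).real {z | |z - y| ≤ c} ^ 2 ≤ ε + K * |S i j| := by
  have ht := (ENNReal.tendsto_toReal (by finiteness)).comp (tendsto_gaussian_pair m y c)
  obtain ⟨η, hη, hb⟩ := Metric.eventually_nhds_iff.1
    (ht.eventually_le_const (lt_add_of_pos_right _ hε))
  -- The pair probability depends on `S` only through `S i j`, so one `η` serves every vector. When
  -- |S i j| ≥ η, the term `η⁻¹ * |S i j|` already exceeds the trivial bound 1.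
  refine ⟨η⁻¹, by positivity, fun L S hS hd i j => ?_⟩
  by_cases h : |S i j| < η
  · have h1 := hb (y := S i j) (by simpa using h)
    have h2 := multivariateGaussian_pair (m := m) hS hd i j (A := {z | |z - y| ≤ c})
      (measurableSet_le (by fun_prop) (by fun_prop))
    simp only [Set.mem_ofPred_eq] at h2
    rw [measureReal_def, h2, measureReal_def]
    simp only [Function.comp_apply, ENNReal.toReal_pow] at h1
    have : 0 ≤ η⁻¹ * |S i j| := by positivity
    linarith
  · have h1 : 1 ≤ η⁻¹ * |S i j| := by
      rw [inv_mul_eq_div, one_le_div hη]; exact not_lt.1 h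
    have h2 : (multivariateGaussian (WithLp.toLp 2 fun _ => m) S).real
          {z | |z i - y| ≤ c ∧ |z j - y| ≤ c} ≤ 1 := measureReal_le_one
    have h3 : 0 ≤ (gaussianReal m 1).real {z | |z - y| ≤ c} ^ 2 := by positivity
    linarith

/-! ### Second moments of sums -/

section Moments

variable {Ω : Type*} [MeasurableSpace Ω] {P : Measure Ω} [IsProbabilityMeasure P]

theorem integrable_of_abs_le {X : Ω → ℝ} {b : ℝ} (hX : AEStronglyMeasurable X P)
    (hb : ∀ ω, |X ω| ≤ b) : Integrable X P :=
  .of_bound hX b (.of_forall hb)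

theorem integrable_mul_of_abs_le {X Z : Ω → ℝ} {b : ℝ} (hX : AEStronglyMeasurable X P)
    (hZ : AEStronglyMeasurable Z P) (hXb : ∀ ω, |X ω| ≤ b) (hZb : ∀ ω, |Z ω| ≤ b) :
    Integrable (fun ω => X ω * Z ω) P :=
  integrable_of_abs_le (b := b * b) (hX.mul hZ) fun ω => by
    rw [abs_mul]
    exact mul_le_mul (hXb ω) (hZb ω) (abs_nonneg _) ((abs_nonneg _).trans (hXb ω))

theorem integral_sum_sq {κ : Type*} [Fintype κ] {T : κ → Ω → ℝ} {b : ℝ}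
    (hT : ∀ s, AEStronglyMeasurable (T s) P) (hb : ∀ s ω, |T s ω| ≤ b) :
    ∫ ω, (∑ s, T s ω) ^ 2 ∂P = ∑ s, ∑ t, ∫ ω, T s ω * T t ω ∂P := by
  have hi : ∀ s t, Integrable (fun ω => T s ω * T t ω) P := fun s t =>
    integrable_mul_of_abs_le (hT s) (hT t) (hb s) (hb t)
  simp_rw [pow_two, Finset.sum_mul_sum]
  rw [integral_finsetSum _ fun s _ => integrable_finsetSum _ fun t _ => hi s t]
  exact Finset.sum_congr rfl fun s _ => integral_finsetSum _ fun t _ => hi s t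

theorem integrable_sum_sq {κ : Type*} [Fintype κ] {T : κ → Ω → ℝ} {b : ℝ}
    (hT : ∀ s, AEStronglyMeasurable (T s) P) (hb : ∀ s ω, |T s ω| ≤ b) :
    Integrable (fun ω => (∑ s, T s ω) ^ 2) P := by
  simp_rw [pow_two, Finset.sum_mul_sum]
  exact integrable_finsetSum _ fun s _ => integrable_finsetSum _ fun t _ =>
    integrable_mul_of_abs_le (hT s) (hT t) (hb s) (hb t)

/-- Independent centred variables, multiplied by weights that are independent of them, are
orthogonal. -/
theorem integral_weighted_sum_sq_le {κ β : Type*} [Fintype κ] [MeasurableSpace β]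
    {U : κ → Ω → ℝ} {E : Ω → β} (hU : ∀ s, AEMeasurable (U s) P) (hE : Measurable E)
    (hindU : iIndepFun U P) (hind : IndepFun (fun ω s => U s ω) E P)
    {v : κ → ℝ → ℝ} {w : κ → β → ℝ} (hv : ∀ s, Measurable (v s)) (hw : ∀ s, Measurable (w s))
    (hv0 : ∀ s, ∫ ω, v s (U s ω) ∂P = 0) {b : ℝ} (hvb : ∀ s x, |v s x| ≤ b)
    (hwb : ∀ s x, |w s x| ≤ 1) :
    Integrable (fun ω => (∑ s, w s (E ω) * v s (U s ω)) ^ 2) P ∧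
      ∫ ω, (∑ s, w s (E ω) * v s (U s ω)) ^ 2 ∂P ≤ Fintype.card κ * b ^ 2 := by
  classical
  have hT : ∀ s, AEStronglyMeasurable (fun ω => w s (E ω) * v s (U s ω)) P := fun s =>
    (((hw s).comp hE).aemeasurable.mul ((hv s).comp_aemeasurable (hU s))).aestronglyMeasurable
  have hb : ∀ s ω, |w s (E ω) * v s (U s ω)| ≤ b := fun s ω => by
    rw [abs_mul]
    exact (mul_le_mul (hwb s _) (hvb s _) (abs_nonneg _) zero_le_one).trans (one_mul b).le
  have hortho : ∀ s t, s ≠ t →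
      ∫ ω, w s (E ω) * v s (U s ω) * (w t (E ω) * v t (U t ω)) ∂P = 0 := fun s t hst => by
    have h1 : IndepFun (fun ω => v s (U s ω) * v t (U t ω))
        (fun ω => w s (E ω) * w t (E ω)) P :=
      hind.comp (φ := fun u : κ → ℝ => v s (u s) * v t (u t))
        (ψ := fun e => w s e * w t e)
        (((hv s).comp (measurable_pi_apply s)).mul ((hv t).comp (measurable_pi_apply t)))
        ((hw s).mul (hw t))
    have h2 : IndepFun (fun ω => v s (U s ω)) (fun ω => v t (U t ω)) P :=
      (hindU.indepFun hst).comp (hv s) (hv t)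
    have hm : ∀ s, AEStronglyMeasurable (fun ω => v s (U s ω)) P := fun s =>
      ((hv s).comp_aemeasurable (hU s)).aestronglyMeasurable
    have hm' : ∀ s, AEStronglyMeasurable (fun ω => w s (E ω)) P := fun s =>
      ((hw s).comp hE).aestronglyMeasurable
    calc ∫ ω, w s (E ω) * v s (U s ω) * (w t (E ω) * v t (U t ω)) ∂P
        = ∫ ω, v s (U s ω) * v t (U t ω) * (w s (E ω) * w t (E ω)) ∂P :=
          integral_congr_ae (.of_forall fun ω => by ring)
      _ = 0 := by
          rw [h1.integral_fun_mul_eq_mul_integral ((hm s).mul (hm t)) ((hm' s).mul (hm' t)),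
            h2.integral_fun_mul_eq_mul_integral (hm s) (hm t), hv0, zero_mul, zero_mul]
  refine ⟨integrable_sum_sq hT hb, ?_⟩
  rw [integral_sum_sq hT hb]
  calc ∑ s, ∑ t, ∫ ω, w s (E ω) * v s (U s ω) * (w t (E ω) * v t (U t ω)) ∂P
      = ∑ s, ∫ ω, w s (E ω) * v s (U s ω) * (w s (E ω) * v s (U s ω)) ∂P :=
        Finset.sum_congr rfl fun s _ =>
          Finset.sum_eq_single s (fun t _ hts => hortho s t hts.symm) (by simp)
    _ ≤ ∑ _s : κ, b ^ 2 := Finset.sum_le_sum fun s _ => by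
        have h := integral_mono (integrable_mul_of_abs_le (hT s) (hT s) (hb s) (hb s))
          (integrable_const (μ := P) (b ^ 2)) fun ω => by
            have := sq_le_sq' (abs_le.1 (hb s ω)).1 (abs_le.1 (hb s ω)).2
            rwa [pow_two (_ * _)] at this
        simpa using h
    _ = Fintype.card κ * b ^ 2 := by simp

/-- The second moment of a sum of centred indicators, from bounds on the pair probabilities. -/
theorem integral_sum_indicator_sub_sq {κ : Type*} [Fintype κ] {J : κ → Set Ω}
    (hJ : ∀ s, MeasurableSet (J s)) {r : ℝ} (hr : ∀ s, P.real (J s) = r) :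
    Integrable (fun ω => (∑ s, ((J s).indicator (fun _ => (1 : ℝ)) ω - r)) ^ 2) P ∧
      ∫ ω, (∑ s, ((J s).indicator (fun _ => (1 : ℝ)) ω - r)) ^ 2 ∂P =
      ∑ s, ∑ t, (P.real (J s ∩ J t) - r ^ 2) := by
  have hI : ∀ A : Set Ω, MeasurableSet A →
      Integrable (A.indicator fun _ => (1 : ℝ)) P := fun A hA =>
    (integrable_const (1 : ℝ)).indicator hA
  have hint : ∀ A : Set Ω, MeasurableSet A →
      ∫ ω, A.indicator (fun _ => (1 : ℝ)) ω ∂P = P.real A := fun A hA => by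
    simp [integral_indicator_const _ hA]
  have hT : ∀ s, AEStronglyMeasurable
      (fun ω => (J s).indicator (fun _ => (1 : ℝ)) ω - r) P := fun s =>
    ((hI _ (hJ s)).sub (integrable_const r)).aestronglyMeasurable
  have hb : ∀ s ω, |(J s).indicator (fun _ => (1 : ℝ)) ω - r| ≤ 1 + |r| := fun s ω =>
    (abs_sub _ _).trans (add_le_add_left (by by_cases h : ω ∈ J s <;> simp [h]) _)
  refine ⟨integrable_sum_sq hT hb, ?_⟩
  rw [integral_sum_sq hT hb]
  refine Finset.sum_congr rfl fun s _ => Finset.sum_congr rfl fun t _ => ?_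
  have hst := (hJ s).inter (hJ t)
  calc _ = ∫ ω, ((J s ∩ J t).indicator (fun _ => (1 : ℝ)) ω
        - r * (J s).indicator (fun _ => (1 : ℝ)) ω
        - r * (J t).indicator (fun _ => (1 : ℝ)) ω + r ^ 2) ∂P := by
        refine integral_congr_ae (.of_forall fun ω => ?_)
        by_cases h1 : ω ∈ J s <;> by_cases h2 : ω ∈ J t <;> simp [h1, h2] <;> ring
    _ = _ := by
        have h1 : Integrable (fun ω => (J s ∩ J t).indicator (fun _ => (1 : ℝ)) ω
            - r * (J s).indicator (fun _ => (1 : ℝ)) ω) P :=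
          (hI _ hst).sub ((hI _ (hJ s)).const_mul r)
        have h2 : Integrable (fun ω => (J s ∩ J t).indicator (fun _ => (1 : ℝ)) ω
            - r * (J s).indicator (fun _ => (1 : ℝ)) ω
            - r * (J t).indicator (fun _ => (1 : ℝ)) ω) P := h1.sub ((hI _ (hJ t)).const_mul r)
        rw [integral_add h2 (integrable_const _), integral_sub h1 ((hI _ (hJ t)).const_mul r),
          integral_sub (hI _ hst) ((hI _ (hJ s)).const_mul r), integral_const_mul,
          integral_const_mul, hint _ hst, hint _ (hJ s), hint _ (hJ t), hr, hr]
        simp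
        ring

end Moments

/-! ### Real-valued calibrators and the mean bound -/

/-- The real-valued version of a calibrator, extended to the negative half-line by a constant. -/
noncomputable def realCalibrator (f : ℝ → ℝ≥0∞) (t : ℝ) : ℝ := (f (max t 0)).toReal

theorem realCalibrator_of_nonneg (f : ℝ → ℝ≥0∞) {t : ℝ} (ht : 0 ≤ t) :
    realCalibrator f t = (f t).toReal := by rw [realCalibrator, max_eq_left ht]

theorem realCalibrator_nonneg (f : ℝ → ℝ≥0∞) (t : ℝ) : 0 ≤ realCalibrator f t :=
  ENNReal.toReal_nonneg

namespace IsBoundedAdmissibleCalibrator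

variable {f : ℝ → ℝ≥0∞}

theorem measurable_realCalibrator (hf : IsBoundedAdmissibleCalibrator f) :
     Measurable (realCalibrator f) := by
  -- Monotonicity is used before `toReal`, which sends f 0 = ∞ to 0 and so destroys it.
  have h : Antitone fun t => f (max t 0) := fun s t hst =>
    hf.antitone (Set.mem_Ici.2 (le_max_right _ _)) (Set.mem_Ici.2 (le_max_right _ _))
      (max_le_max_right 0 hst)
  exact h.measurable.ennreal_toReal

theorem ofReal_realCalibrator (hf : IsBoundedAdmissibleCalibrator f) {t : ℝ} (ht : 0 < t) :
    ENNReal.ofReal (realCalibrator f t) = f t := by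
  obtain ⟨b, -, hb⟩ := hf.bounded
  rw [realCalibrator_of_nonneg f ht.le, ENNReal.ofReal_toReal (hb t ht).ne_top]

theorem exists_realCalibrator_le (hf : IsBoundedAdmissibleCalibrator f) :
    ∃ b : ℝ, 0 < b ∧ ∀ t, realCalibrator f t ≤ b := by
  obtain ⟨b, hb0, hb⟩ := hf.bounded
  refine ⟨b, hb0, fun t => ?_⟩
  rcases le_or_gt t 0 with ht | ht
  -- The value here is `∞.toReal = 0`, so the infinite value at 0 does not spoil the bound.
  · simp [realCalibrator, max_eq_right ht, hf.apply_zero, hb0.le]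
  · rw [realCalibrator_of_nonneg f ht.le]
    exact ENNReal.toReal_le_of_le_ofReal hb0.le (hb t ht).le

theorem intervalIntegrable_realCalibrator (hf : IsBoundedAdmissibleCalibrator f) (s t : ℝ) :
    IntervalIntegrable (realCalibrator f) volume s t := by
  obtain ⟨b, -, hb⟩ := hf.exists_realCalibrator_le
  refine (intervalIntegrable_const (c := b)).mono_fun
    hf.measurable_realCalibrator.aestronglyMeasurable (.of_forall fun x => ?_)
  simp only [Real.norm_of_nonneg (realCalibrator_nonneg f x)]
  exact (hb x).trans (le_abs_self b)

theorem integral_realCalibrator_eq_one (hf : IsBoundedAdmissibleCalibrator f) :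
    ∫ t in (0 : ℝ)..1, realCalibrator f t = 1 := by
  rw [intervalIntegral.integral_of_le zero_le_one,
    integral_eq_lintegral_of_nonneg_ae (.of_forall (realCalibrator_nonneg f))
      hf.measurable_realCalibrator.aestronglyMeasurable,
    setLIntegral_congr_fun measurableSet_Ioc
      (fun t ht => hf.ofReal_realCalibrator ht.1), setLIntegral_congr Ioc_ae_eq_Icc,
    hf.lintegral_eq_one, ENNReal.toReal_one]

end IsBoundedAdmissibleCalibrator

theorem integral_cond_Ioo {a b : ℝ} (hab : a < b) (g : ℝ → ℝ) :
    ∫ x, g x ∂(cond volume (Set.Ioo a b)) = (b - a)⁻¹ * ∫ x in a..b, g x := by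
  rw [ProbabilityTheory.cond, integral_smul_measure, Real.volume_Ioo,
    intervalIntegral.integral_of_le hab.le, integral_Ioc_eq_integral_Ioo, smul_eq_mul,
    ENNReal.toReal_inv, ENNReal.toReal_ofReal (sub_pos.2 hab).le]

/-- `Γ` bounds the mean of the calibrated synthetic p-value from below. -/
theorem Gam_le {f : ℝ → ℝ≥0∞} (hf : IsBoundedAdmissibleCalibrator f) {α α' q : ℝ}
    (hα : α ∈ Set.Ioo (0 : ℝ) 1) (hα' : α' ∈ Set.Ioo (0 : ℝ) 1) (hq : q ≤ 1) :
    Gam f α α' q ≤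
      q * (∫ x, realCalibrator f (x / α') ∂(cond volume (Set.Ioo 0 α)))
        + (1 - q) * ∫ x, realCalibrator f (x / α') ∂(cond volume (Set.Ioo α 1)) := by
  obtain ⟨hα0, hα1⟩ := hα
  obtain ⟨hα'0, hα'1⟩ := hα'
  have hdiv : 0 ≤ α / α' := by positivity
  have hI := hf.intervalIntegrable_realCalibrator
  rw [integral_cond_Ioo hα0, integral_cond_Ioo hα1,
    intervalIntegral.integral_comp_div _ hα'0.ne', intervalIntegral.integral_comp_div _ hα'0.ne',
    ← intervalIntegral.integral_add_adjacent_intervals (hI (α / α') 1) (hI 1 (1 / α')),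
    zero_div, Gam]
  have hcongr : ∀ {s t : ℝ}, 0 ≤ s → 0 ≤ t →
      ∫ x in s..t, (f x).toReal = ∫ x in s..t, realCalibrator f x := fun hs ht =>
    intervalIntegral.integral_congr fun x hx =>
      (realCalibrator_of_nonneg f ((le_min hs ht).trans hx.1)).symm
  rw [hcongr le_rfl hdiv, hcongr hdiv zero_le_one]
  have hsum := intervalIntegral.integral_add_adjacent_intervals (hI 0 (α / α')) (hI (α / α') 1)
  rw [hf.integral_realCalibrator_eq_one] at hsum
  have hJ : 0 ≤ ∫ x in (1 : ℝ)..1 / α', realCalibrator f x :=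
    intervalIntegral.integral_nonneg ((one_le_div hα'0).2 hα'1.le) fun x _ =>
      realCalibrator_nonneg f x
  set I₁ := ∫ x in (0 : ℝ)..α / α', realCalibrator f x
  set I₂ := ∫ x in (α / α')..1, realCalibrator f x
  set J := ∫ x in (1 : ℝ)..1 / α', realCalibrator f x
  have h1 : 0 < 1 - α := sub_pos.2 hα1
  -- Since I₁ + I₂ = 1, the mean exceeds Γ exactly by the contribution of `f` on [1, 1/α'], which Γ
  -- leaves out. With oriented integrals no case split on α ≤ α' is needed.
  have hkey : q * ((α - 0)⁻¹ * α' • I₁) + (1 - q) * ((1 - α)⁻¹ * α' • (I₂ + J))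
      - ((α' / α * I₁ - α' / (1 - α) * I₂) * (q - α) + α') = (1 - q) * α' * J / (1 - α) := by
    have : I₁ = 1 - I₂ := by linarith
    rw [this]
    simp only [smul_eq_mul]
    field_simp
    ring
  have : 0 ≤ (1 - q) * α' * J / (1 - α) :=
    div_nonneg (mul_nonneg (mul_nonneg (sub_nonneg.2 hq) hα'0.le) hJ) h1.le
  linarith

theorem aggregateP_le {f : ℝ → ℝ≥0∞} (hf : IsBoundedAdmissibleCalibrator f) {α' : ℝ}
    (hα' : α' ∈ Set.Ioo (0 : ℝ) 1) {L : ℕ} (hL : 0 < L) {p : Fin L → ℝ}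
    (hp : ∀ ℓ, p ℓ ∈ Set.Ioo (0 : ℝ) 1) (hsum : (L : ℝ) ≤ ∑ ℓ, realCalibrator f (p ℓ / α')) :
    aggregateP (fun _ : Fin L => (L : ℝ≥0)⁻¹) (fun _ => f) p ≤ α' := by
  refine csInf_le ⟨0, ?_⟩ (Set.mem_insert_of_mem _ ⟨hα', fun ℓ => Set.Ioo_subset_Icc_self (hp ℓ), ?_⟩)
  · rintro a (rfl | ha)
    · exact zero_le_one
    · exact ha.1.1.le
  · have hL' : (0 : ℝ) < L := Nat.cast_pos.2 hL
    have hterm : ∀ ℓ, (((L : ℝ≥0)⁻¹ : ℝ≥0) : ℝ≥0∞) * f (p ℓ / α') =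
        ENNReal.ofReal ((L : ℝ)⁻¹ * realCalibrator f (p ℓ / α')) := fun ℓ => by
      rw [ENNReal.ofReal_mul (by positivity),
        hf.ofReal_realCalibrator (div_pos (hp ℓ).1 hα'.1), ENNReal.ofReal,
        Real.toNNReal_inv, Real.toNNReal_natCast]
    simp_rw [hterm]
    rw [← ENNReal.ofReal_sum_of_nonneg fun ℓ _ =>
      mul_nonneg (by positivity) (realCalibrator_nonneg f _), ← Finset.mul_sum,
      ENNReal.one_le_ofReal, inv_mul_eq_div, one_le_div hL']
    exact hsum

/-! ### Concentration and exclusion from the merged set -/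

/-- Chebyshev's inequality for sums of functions of synthetic p-values. -/
theorem sum_synthetic_lt_bound {ι Ω : Type*} [Fintype ι] [MeasurableSpace Ω] {P : Measure Ω}
    [IsProbabilityMeasure P] {y α : ℝ} {C : ι → Ω → Set ℝ}
    (hC : ∀ ℓ, MeasurableSet {ω | y ∈ C ℓ ω}) {U₁ U₂ : ι → Ω → ℝ}
    (hU : IsSyntheticDraw P y (fun _ => α) C U₁ U₂) {r : ℝ}
    (hr : ∀ ℓ, P.real {ω | y ∈ C ℓ ω} = r) {g : ℝ → ℝ} (hg : Measurable g) {b : ℝ}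
    (hg0 : ∀ x, 0 ≤ g x) (hgb : ∀ x, g x ≤ b) {A B d : ℝ}
    (hA : A = ∫ x, g x ∂(cond volume (Set.Ioo 0 α)))
    (hB : B = ∫ x, g x ∂(cond volume (Set.Ioo α 1)))
    (hd : 0 ≤ d) (hm : 1 + d ≤ (1 - r) * A + r * B) :
    (Fintype.card ι * d) ^ 2 *
      P.real {ω | ∑ ℓ, g (syntheticP y (C ℓ ω) (U₁ ℓ ω) (U₂ ℓ ω)) < Fintype.card ι} ≤
      2 * (B - A) ^ 2 * ∑ i, ∑ j, (P.real ({ω | y ∈ C i ω} ∩ {ω | y ∈ C j ω}) - r ^ 2)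
        + 4 * Fintype.card ι * b ^ 2 := by
  classical
  have hint₁ : ∀ ℓ, ∫ ω, g (U₁ ℓ ω) ∂P = A := fun ℓ => by
    rw [hA, ← (hU.law₁ ℓ).integral_comp hg.aestronglyMeasurable]; rfl
  have hint₂ : ∀ ℓ, ∫ ω, g (U₂ ℓ ω) ∂P = B := fun ℓ => by
    rw [hB, ← (hU.law₂ ℓ).integral_comp hg.aestronglyMeasurable]; rfl
  have hgabs : ∀ x, |g x| ≤ b := fun x => by rw [abs_of_nonneg (hg0 x)]; exact hgb x
  let mean : ι ⊕ ι → ℝ := Sum.elim (fun _ => A) fun _ => B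
  let v : ι ⊕ ι → ℝ → ℝ := fun s x => g x - mean s
  -- Both draws of every set enter as independent centred variables; the weights, functions of the
  -- coverage indicators, switch on exactly one of the two.
  let w : ι ⊕ ι → (ι → Prop) → ℝ :=
    Sum.elim (fun ℓ e => if e ℓ then 0 else 1) fun ℓ e => if e ℓ then 1 else 0
  have hUm : ∀ s, AEMeasurable (Sum.elim U₁ U₂ s) P := by
    rintro (ℓ | ℓ)
    exacts [(hU.law₁ ℓ).aemeasurable, (hU.law₂ ℓ).aemeasurable]
  have hgi : ∀ s, Integrable (fun ω => g (Sum.elim U₁ U₂ s ω)) P := fun s =>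
    integrable_of_abs_le (hg.comp_aemeasurable (hUm s)).aestronglyMeasurable fun ω => hgabs _
  have hmean : ∀ s, ∫ ω, g (Sum.elim U₁ U₂ s ω) ∂P = mean s := by
    rintro (ℓ | ℓ)
    exacts [hint₁ ℓ, hint₂ ℓ]
  have hmean0 : ∀ s, 0 ≤ mean s := fun s => by
    rw [← hmean]; exact integral_nonneg fun ω => hg0 _
  have hmeanb : ∀ s, mean s ≤ b := fun s => by
    rw [← hmean]
    simpa using integral_mono (hgi s) (integrable_const (μ := P) b) fun ω => hgb _
  obtain ⟨hY, hYb⟩ := integral_weighted_sum_sq_le (P := P) (v := v) (w := w) (b := b) hUm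
    (E := fun ω ℓ => y ∈ C ℓ ω) (measurable_pi_iff.2 fun ℓ => measurableSet_setOfPred.1 (hC ℓ))
    hU.indep hU.indep_sets (fun s => hg.sub_const _)
    (by
      rintro (ℓ | ℓ) <;>
      exact (measurable_from_top (f := fun q : Prop => if q then (_ : ℝ) else _)).comp
        (measurable_pi_apply ℓ))
    (fun s => by rw [integral_sub (hgi s) (integrable_const _), hmean]; simp)
    -- Value and mean both lie in [0, b], so their difference is bounded by `b` rather than 2b.
    (fun s x => abs_sub_le_iff.2 ⟨by linarith [hgb x, hmean0 s], by linarith [hg0 x, hmeanb s]⟩)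
    (by rintro (ℓ | ℓ) e <;> simp only [w, Sum.elim_inl, Sum.elim_inr] <;> split_ifs <;> simp)
  obtain ⟨hX, hXb⟩ := integral_sum_indicator_sub_sq (P := P) hC hr
  set X : Ω → ℝ := fun ω => ∑ ℓ, ({ω | y ∈ C ℓ ω}.indicator (fun _ => (1 : ℝ)) ω - r)
  set Y : Ω → ℝ := fun ω => ∑ s, w s (fun ℓ => y ∈ C ℓ ω) * v s (Sum.elim U₁ U₂ s ω)
  have hdecomp : ∀ ω, ∑ ℓ, g (syntheticP y (C ℓ ω) (U₁ ℓ ω) (U₂ ℓ ω)) =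
      Fintype.card ι * ((1 - r) * A + r * B) + ((B - A) * X ω + Y ω) := fun ω => by
    simp only [X, Y, Fintype.sum_sum_type, w, v, mean, Sum.elim_inl, Sum.elim_inr,
      Finset.mul_sum, ← Finset.sum_add_distrib]
    rw [← nsmul_eq_mul, ← Finset.card_univ, ← Finset.sum_const, ← Finset.sum_add_distrib]
    refine Finset.sum_congr rfl fun ℓ _ => ?_
    by_cases h : y ∈ C ℓ ω <;> simp [h, syntheticP] <;> ring
  -- Markov is applied to the majorant from (u + v)² ≤ 2u² + 2v², which avoids the cross term. The 4
  -- in the bound is this 2 times the 2 from `card (ι ⊕ ι)`.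
  have hH : Integrable (fun ω => 2 * (B - A) ^ 2 * X ω ^ 2 + 2 * Y ω ^ 2) P :=
    (hX.const_mul _).add (hY.const_mul _)
  have hmarkov := mul_meas_ge_le_integral_of_nonneg
    (.of_forall fun ω => by simp only [Pi.zero_apply]; positivity) hH ((Fintype.card ι * d) ^ 2)
  have hsub : P.real {ω | ∑ ℓ, g (syntheticP y (C ℓ ω) (U₁ ℓ ω) (U₂ ℓ ω)) < Fintype.card ι} ≤
      P.real {ω | (Fintype.card ι * d) ^ 2 ≤ 2 * (B - A) ^ 2 * X ω ^ 2 + 2 * Y ω ^ 2} := by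
    refine measureReal_mono fun ω hω => ?_
    rw [Set.mem_ofPred_eq, hdecomp] at hω
    have hn : (0 : ℝ) ≤ Fintype.card ι := by positivity
    have h1 := mul_le_mul_of_nonneg_left hm hn
    have h2 : Fintype.card ι * d ≤ -((B - A) * X ω + Y ω) := by linarith
    have h3 := pow_le_pow_left₀ (mul_nonneg hn hd) h2 2
    have h4 := sq_nonneg ((B - A) * X ω - Y ω)
    simp only [Set.mem_ofPred_eq]
    nlinarith
  refine (mul_le_mul_of_nonneg_left hsub (sq_nonneg _)).trans (hmarkov.trans ?_)
  rw [integral_add (hX.const_mul _) (hY.const_mul _), integral_const_mul, integral_const_mul, hXb]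
  simp only [Fintype.card_sum, Nat.cast_add] at hYb
  linarith

theorem ae_mem_Ioo_of_hasLaw_cond {Ω : Type*} [MeasurableSpace Ω] {P : Measure Ω} {U : Ω → ℝ}
    {a b : ℝ} (h : HasLaw U (cond volume (Set.Ioo a b)) P) : ∀ᵐ ω ∂P, U ω ∈ Set.Ioo a b :=
  (h.ae_iff (p := fun x => x ∈ Set.Ioo a b) measurableSet_Ioo.mem).2
    (ae_cond_mem measurableSet_Ioo)

theorem notMem_mergedSet_bound {Ω : Type*} [MeasurableSpace Ω] {P : Measure Ω}
    [IsProbabilityMeasure P] {Y : Set ℝ} {y α α' : ℝ} (hα : α ∈ Set.Ioo (0 : ℝ) 1)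
    (hα' : α' ∈ Set.Ioo (0 : ℝ) 1) {L : ℕ} (hL : 0 < L)
    {C : Fin L → Ω → Set ℝ} {U₁ U₂ : ℝ → Fin L → Ω → ℝ}
    (hU : IsSyntheticDraw P y (fun _ => α) C (U₁ y) (U₂ y))
    {f : ℝ → ℝ≥0∞} (hf : IsBoundedAdmissibleCalibrator f) :
    1 - P.real {ω | ∑ ℓ, realCalibrator f
        (syntheticP y (C ℓ ω) (U₁ y ℓ ω) (U₂ y ℓ ω) / α') < L} ≤
      P.real {ω | y ∉ mergedSet Y (fun _ : Fin L => (L : ℝ≥0)⁻¹) (fun _ => f)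
          (fun y' ℓ => syntheticP y' (C ℓ ω) (U₁ y' ℓ ω) (U₂ y' ℓ ω)) α'} := by
  set N := {ω | y ∉ mergedSet Y (fun _ : Fin L => (L : ℝ≥0)⁻¹) (fun _ => f)
          (fun y' ℓ => syntheticP y' (C ℓ ω) (U₁ y' ℓ ω) (U₂ y' ℓ ω)) α'} with hN
  have hae : ∀ᵐ ω ∂P, ∀ ℓ, U₁ y ℓ ω ∈ Set.Ioo 0 α ∧ U₂ y ℓ ω ∈ Set.Ioo α 1 :=
    ae_all_iff.2 fun ℓ => (ae_mem_Ioo_of_hasLaw_cond (hU.law₁ ℓ)).and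
      (ae_mem_Ioo_of_hasLaw_cond (hU.law₂ ℓ))
  have hle : P Nᶜ ≤ P {ω | ∑ ℓ, realCalibrator f
        (syntheticP y (C ℓ ω) (U₁ y ℓ ω) (U₂ y ℓ ω) / α') < L} := by
    refine measure_mono_ae ?_
    filter_upwards [hae] with ω hω (hmem : ω ∈ Nᶜ)
    by_contra hlt
    refine hmem fun h => h.2.not_ge (aggregateP_le hf hα' hL (fun ℓ => ?_) (not_lt.1 hlt))
    simp only [syntheticP]
    split_ifs
    · exact ⟨hα.1.trans (hω ℓ).2.1, (hω ℓ).2.2⟩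
    · exact ⟨(hω ℓ).1.1, (hω ℓ).1.2.trans hα.2⟩
  have hle' := ENNReal.toReal_mono (by finiteness) hle
  -- The event `N` has not been shown measurable; subadditivity still gives the needed lower bound
  -- for it.
  have hone : P.real (N ∪ Nᶜ) ≤ P.real N + P.real Nᶜ := measureReal_union_le _ _
  rw [Set.union_compl_self, probReal_univ] at hone
  rw [← measureReal_def, ← measureReal_def] at hle'
  linarith

/-- The deviation bounds of `sum_synthetic_lt_bound`, with pair probabilities controlled by weakly
dependent correlations, vanish as the number of sets grows. -/
theorem tendsto_one_of_weak {u s : ℕ → ℝ} {c₁ c₂ : ℝ} (hc₁ : 0 ≤ c₁)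
    (hu : ∀ L, u L ≤ 1) (hs : Tendsto s atTop (𝓝 0))
    (h : ∀ ε > 0, ∃ K : ℝ, ∀ L : ℕ, 0 < L →
      1 - (c₁ * (ε + K * s L) + c₂ * (L : ℝ)⁻¹) ≤ u L) :
    Tendsto u atTop (𝓝 1) := by
  refine tendsto_order.2 ⟨fun a ha => ?_, fun a ha => .of_forall fun L => (hu L).trans_lt ha⟩
  -- This ε makes c₁ε < 1 - a; the `+ 1` covers c₁ = 0.
  obtain ⟨K, hK⟩ := h ((1 - a) / (c₁ + 1)) (div_pos (sub_pos.2 ha) (by positivity))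
  have ht : Tendsto (fun L : ℕ => 1 - (c₁ * ((1 - a) / (c₁ + 1) + K * s L) + c₂ * (L : ℝ)⁻¹))
      atTop (𝓝 (1 - (c₁ * ((1 - a) / (c₁ + 1) + K * 0) + c₂ * 0))) :=
    tendsto_const_nhds.sub (((tendsto_const_nhds.add (hs.const_mul K)).const_mul c₁).add
      (tendsto_inv_atTop_nhds_zero_nat.const_mul c₂))
  have hlt : a < 1 - (c₁ * ((1 - a) / (c₁ + 1) + K * 0) + c₂ * 0) := by
    have : c₁ * ((1 - a) / (c₁ + 1)) < 1 - a := by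
      rw [mul_div_assoc', div_lt_iff₀ (by positivity)]
      nlinarith
    simp only [mul_zero, add_zero]
    linarith
  filter_upwards [ht.eventually_const_lt hlt, eventually_gt_atTop 0] with L hL hL0
  exact hL.trans_le (hK L hL0)

/-! ### Laws of the coverage indicators -/

namespace IsWeaklyDependent

variable {Ω : ℕ → Type*} [∀ L, MeasurableSpace (Ω L)] {P : ∀ L, Measure (Ω L)} {Y : Set ℝ}
  {δ m α : ℝ} {S : ∀ L, Matrix (Fin L) (Fin L) ℝ} {C : ∀ L, Fin L → Ω L → Set ℝ}

theorem tendsto_mean_abs {μ : ∀ L, EuclideanSpace ℝ (Fin L)} {a : ∀ L, Fin L → ℝ}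
    (h : IsWeaklyDependent P Y δ μ S a C) :
    Tendsto (fun L : ℕ => ((L : ℝ) ^ 2)⁻¹ * ∑ i, ∑ j, |S L i j|) atTop (𝓝 0) :=
  h.weak.trans_tendsto ((tendsto_rpow_neg_atTop h.delta_pos).comp tendsto_natCast_atTop_atTop)

theorem pair_law (h : IsWeaklyDependent P Y δ (fun _ => WithLp.toLp 2 fun _ => m) S
      (fun _ _ => α) C) (hS : ∀ L ℓ, S L ℓ ℓ = 1) {y : ℝ} (hy : y ∈ Y) (L : ℕ) (i j : Fin L) :
    (P L).real ({ω | y ∈ C L i ω} ∩ {ω | y ∈ C L j ω}) =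
      (multivariateGaussian (WithLp.toLp 2 fun _ => m) (S L)).real
        {z | |z i - y| ≤ normalQuantile (1 - α / 2) ∧
          |z j - y| ≤ normalQuantile (1 - α / 2)} := by
  classical
  -- The case i = j is allowed; it yields the marginal law in `single_law`.
  have := h.joint_law y hy L {i, j}
  simp only [Finset.mem_insert, Finset.mem_singleton, forall_eq_or_imp, forall_eq, hS,
    Real.sqrt_one, div_one] at this
  rw [measureReal_def, measureReal_def, ← this]
  rfl

theorem single_law (h : IsWeaklyDependent P Y δ (fun _ => WithLp.toLp 2 fun _ => m) S
      (fun _ _ => α) C) (hS : ∀ L ℓ, S L ℓ ℓ = 1) {y : ℝ} (hy : y ∈ Y) (L : ℕ) (i : Fin L) :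
    (P L).real {ω | y ∈ C L i ω} =
      (gaussianReal m 1).real {z | |z - y| ≤ normalQuantile (1 - α / 2)} := by
  have h1 := h.pair_law hS hy L i i
  simp only [Set.inter_self, and_self] at h1
  have h2 := (measurePreserving_eval_multivariateGaussian
    (μ := WithLp.toLp 2 fun _ : Fin L => m) (h.posSemidef L) (i := i)).hasLaw.measureReal_eq
    (p := fun z => |z - y| ≤ normalQuantile (1 - α / 2))
    (measurableSet_le (by fun_prop) (by fun_prop))
  simp only [hS, Real.toNNReal_one] at h2
  rw [h1, h2]

end IsWeaklyDependent

end SAT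

/-! ### Assembly -/

theorem mainTheorem8
    {Ω : ℕ → Type*} [∀ L, MeasurableSpace (Ω L)]
    (P : ∀ L, Measure (Ω L)) [∀ L, IsProbabilityMeasure (P L)]
    (Y : Set ℝ) (α : ℝ) (hα : α ∈ Set.Ioo (0 : ℝ) 1)
    -- the initial random sets `C L ℓ` for `L` studies, whose coverage events are measurable
    (C : ∀ L, Fin L → Ω L → Set ℝ)
    (hC : ∀ y ∈ Y, ∀ L ℓ, MeasurableSet {ω | y ∈ C L ℓ ω})
    -- weak dependence with `Z ∼ N(μ* 1_L, S)` and unit variances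
    (δ μstar : ℝ) (S : ∀ L, Matrix (Fin L) (Fin L) ℝ) (hS : ∀ L ℓ, S L ℓ ℓ = 1)
    (hweak : SAT.IsWeaklyDependent P Y δ (fun _ => WithLp.toLp 2 fun _ => μstar) S
      (fun _ _ => α) C)
    -- the uniform draws behind the synthetic p-values at each candidate
    (U₁ U₂ : ∀ L, ℝ → Fin L → Ω L → ℝ)
    (hU : ∀ y ∈ Y, ∀ L, SAT.IsSyntheticDraw (P L) y (fun _ => α) (C L) (U₁ L y) (U₂ L y))
    (f : ℝ → ℝ≥0∞) (hf : SAT.IsBoundedAdmissibleCalibrator f)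
    (α' : ℝ) (hα' : α' ∈ Set.Ioo (0 : ℝ) 1)
    (y : ℝ) (hy : y ∈ Y)
    -- `ℙ(y ∉ C_{1,α})` is the same number for every `L₀ ≥ 1`
    (L₀ : ℕ) (hL₀ : 0 < L₀)
    (hΓ : 1 < SAT.Gam f α α' ((P L₀).real {ω | y ∉ C L₀ ⟨0, hL₀⟩ ω})) :
    Tendsto
      (fun L : ℕ => (P L).real
        {ω | y ∉ SAT.mergedSet Y (fun _ : Fin L => (L : ℝ≥0)⁻¹) (fun _ => f)
          (fun y' ℓ => SAT.syntheticP y' (C L ℓ ω) (U₁ L y' ℓ ω) (U₂ L y' ℓ ω)) α'})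
      atTop (𝓝 1) := by
  set c := SAT.normalQuantile (1 - α / 2) with hc
  set r := (gaussianReal μstar 1).real {z | |z - y| ≤ c} with hr
  have hsingle : ∀ L ℓ, (P L).real {ω | y ∈ C L ℓ ω} = r := hweak.single_law hS hy
  have hq : (P L₀).real {ω | y ∉ C L₀ ⟨0, hL₀⟩ ω} = 1 - r := by
    rw [← hsingle L₀ ⟨0, hL₀⟩, ← probReal_compl_eq_one_sub (hC y hy L₀ _)]
    rfl
  have hr0 : 0 ≤ r := measureReal_nonneg
  rw [hq] at hΓ
  have hΓ' := SAT.Gam_le hf hα hα' (q := 1 - r) (by linarith)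
  rw [sub_sub_cancel] at hΓ'
  set A := ∫ x, SAT.realCalibrator f (x / α') ∂(cond volume (Set.Ioo 0 α)) with hA
  set B := ∫ x, SAT.realCalibrator f (x / α') ∂(cond volume (Set.Ioo α 1)) with hB
  obtain ⟨b, -, hb⟩ := hf.exists_realCalibrator_le
  -- The excess of the mean over the threshold 1: failure requires the centred sum to fall below -L
  -- d.
  set d := (1 - r) * A + r * B - 1 with hd
  have hd0 : 0 < d := by linarith
  refine SAT.tendsto_one_of_weak (c₁ := 2 * (B - A) ^ 2 / d ^ 2) (c₂ := 4 * b ^ 2 / d ^ 2)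
    (by positivity) (fun L => measureReal_le_one) hweak.tendsto_mean_abs fun ε hε => ?_
  obtain ⟨K, -, hK⟩ := SAT.gaussian_pair_bound μstar y c hε
  refine ⟨K, fun L hL => ?_⟩
  refine le_trans (sub_le_sub_left ?_ 1)
    (SAT.notMem_mergedSet_bound hα hα' hL (hU y hy L) hf)
  have hmain := SAT.sum_synthetic_lt_bound (hC y hy L) (hU y hy L) (hsingle L)
    (hf.measurable_realCalibrator.comp (measurable_id.div_const α'))
    (fun x => SAT.realCalibrator_nonneg f _) (fun x => hb _) hA hB hd0.le (by linarith)
  have hcov : ∑ i, ∑ j, ((P L).real ({ω | y ∈ C L i ω} ∩ {ω | y ∈ C L j ω}) - r ^ 2) ≤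
      (L : ℝ) ^ 2 * ε + K * ∑ i, ∑ j, |S L i j| := by
    calc _ ≤ ∑ i, ∑ j, (ε + K * |S L i j|) :=
          Finset.sum_le_sum fun i _ => Finset.sum_le_sum fun j _ => by
            rw [hweak.pair_law hS hy]
            exact hK L (S L) (hweak.posSemidef L) (hS L) i j
      _ = _ := by
          simp only [Finset.sum_add_distrib, ← Finset.mul_sum, Finset.sum_const,
            Finset.card_univ, Fintype.card_fin, nsmul_eq_mul]
          ring
  have hL' : (0 : ℝ) < L := Nat.cast_pos.2 hL
  simp only [Fintype.card_fin, Function.comp_apply, id] at hmain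
  have hbound := hmain.trans (add_le_add_left (mul_le_mul_of_nonneg_left hcov
    (by positivity : 0 ≤ 2 * (B - A) ^ 2)) _)
  -- Division by (L d)² turns the L² pairs into `c₁` times ε plus K times the mean correlation, and
  -- the O(L) noise into `c₂` / L.
  rw [← le_div_iff₀' (by positivity)] at hbound
  refine hbound.trans (le_of_eq ?_)
  field_simp
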